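/- A class of groups is a family of groups closed under isomorphism. Given classes \(\mathcal{R}\) and \(\mathcal{C}\), a group \(G\) is \(\mathcal{R}\)-by-\(\mathcal{C}\) if it has a normal subgroup \(N\in\mathcal{R}\) with \(G/N\in\mathcal{C}\); it is residually \(\mathcal{C}\) if for every \(g\in G\setminus\{e\}\) there are \(Q\in\mathcal{C}\) and a surjective homomorphism \(\varphi\colon G\to Q\) with \(\varphi(g)\neq e\). A root class is a class \(\mathcal{R}\) which contains a non-trivial group, is closed under subgroups and under finite direct products, and satisfies the Gruenberg condition: for any chain \(K\trianglelefteq H\trianglelefteq G\) with \(G/H\in\mathcal{R}\) and \(H/K\in\mathcal{R}\) there is \(L\trianglelefteq G\) with \(L\leq K\) and \(G/L\in\mathcal{R}\). If \(\mathcal{C}\) is closed under subgroups and finite direct products, the pro-\(\mathcal{C}\) topology of a group \(A\) is the group topology for which the normal subgroups \(N\trianglelefteq A\) with \(A/N\in\mathcal{C}\) form a basis of neighbourhoods of \(e\). Theorem. Let \(A\) be a group, let \(H\leq A\) be a subgroup, and let \(G=\langle A,t\mid t^{-1}ht=h\ \text{for all } h\in H\rangle\) be the special HNN extension of \(A\)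 with associated subgroup \(H\). Let \(\mathcal{C}\) be a class of groups that contains a root class \(\mathcal{R}\). Suppose that 1. \(\mathcal{C}\) is closed under subgroups and finite direct products; 2. every \(\mathcal{R}\)-by-\(\mathcal{C}\) group belongs to \(\mathcal{C}\); 3. for every group in \(\mathcal{C}\) there is a group in \(\mathcal{R}\) of the same cardinality. Then \(G\) is residually \(\mathcal{C}\) if and only if \(A\) is residually \(\mathcal{C}\) and \(H\) is closed in the pro-\(\mathcal{C}\) topology of \(A\). -/

import Mathlib

universe u

/-- A class of groups: a property of groups that is invariant under isomorphism. -/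
structure GroupClass where
  /-- `Mem G` says that the group `G` belongs to the class. -/
  Mem : ∀ (G : Type u) [Group G], Prop
  mem_of_mulEquiv : ∀ {G K : Type u} [Group G] [Group K], (G ≃* K) → Mem G → Mem K

namespace GroupClass

/-- The class contains every subgroup of each of its members. -/
def SubgroupClosed (C : GroupClass.{u}) : Prop :=
  ∀ (G : Type u) [Group G], C.Mem G → ∀ K : Subgroup G, C.Mem K

/-- The class contains the direct product of any two of its members (hence, by induction, of
any nonempty finite family of its members). -/
def ProdClosed (C : GroupClass.{u}) : Prop :=
  ∀ (G K : Type u) [Group G] [Group K], C.Mem G → C.Mem K → C.Mem (G × K)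

/-- The Gruenberg condition: for every chain `K ⊴ H ⊴ G` with `G / H` and `H / K` in the class
there is `L ⊴ G` contained in `K` with `G / L` in the class. A subgroup of `G` contained in `H`
is written as the image in `G` of a subgroup `K` of `H`. -/
def GruenbergCondition (C : GroupClass.{u}) : Prop :=
  ∀ (G : Type u) [Group G] (H : Subgroup G) [H.Normal] (K : Subgroup H) [K.Normal],
    C.Mem (G ⧸ H) → C.Mem (H ⧸ K) →
      ∃ (L : Subgroup G) (_ : L.Normal), L ≤ K.map H.subtype ∧ C.Mem (G ⧸ L)

/-- A root class: a class that contains a nontrivial group, is closed under subgroups and finite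
direct products, and satisfies the Gruenberg condition. -/
structure IsRootClass (R : GroupClass.{u}) : Prop where
  exists_nontrivial : ∃ (G : Type u) (_ : Group G), Nontrivial G ∧ R.Mem G
  subgroupClosed : R.SubgroupClosed
  prodClosed : R.ProdClosed
  gruenberg : R.GruenbergCondition

/-- `G` is `R`-by-`C`: it has a normal subgroup in `R` whose quotient is in `C`. -/
def IsExtensionBy (R C : GroupClass.{u}) (G : Type u) [Group G] : Prop :=
  ∃ (N : Subgroup G) (_ : N.Normal), R.Mem N ∧ C.Mem (G ⧸ N)

/-- `G` is residually `C`: every nontrivial element survives in some quotient belonging to `C`. -/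
def IsResidually (C : GroupClass.{u}) (G : Type u) [Group G] : Prop :=
  ∀ g : G, g ≠ 1 → ∃ (Q : Type u) (_ : Group Q) (f : G →* Q),
    C.Mem Q ∧ Function.Surjective f ∧ f g ≠ 1

/-- The pro-`C` topology of `G`: the topology generated by all cosets `gN` of normal subgroups `N`
with `G / N` in `C`. When these subgroups are closed under finite intersections, they
form a basis of neighbourhoods of `1`. -/
abbrev proTopology (C : GroupClass.{u}) (G : Type u) [Group G] : TopologicalSpace G :=
  TopologicalSpace.generateFrom
    {U : Set G | ∃ (N : Subgroup G) (_ : N.Normal) (g : G),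
      C.Mem (G ⧸ N) ∧ U = {x : G | g⁻¹ * x ∈ N}}

end GroupClass

/-- The special HNN extension `⟨A, t ∣ t⁻¹ h t = h for all h ∈ H⟩` of `A` with associated
subgroup `H`: the HNN extension along the identity isomorphism of `H`. -/
abbrev SpecialHNNExtension (A : Type u) [Group A] (H : Subgroup A) : Type u :=
  HNNExtension A H H (MulEquiv.refl H)

/-! ### Classes of groups, separation from a subgroup, and the pro-`C` topology -/

namespace GroupClass

variable {C : GroupClass.{u}}

/-! If `a ∉ H`, the commutator of `t` and `a` is nontrivial, and any quotient in which it survives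
separates `a` from `H`; this gives necessity.

For sufficiency, elements of `H` are detected by killing `t`. Any other element is a reduced word,
and `separates_reduced` separates it from `H` by induction on length. Let `f : G → Q` with `Q` in
`C` separate the relevant shorter subwords, and let `P` in `R` have an element `p ≠ 1`. Lift `f` to
`P ≀ Q` by sending `A` into the complement and `t` to `f t` times the function equal to `p` on `f H`
and `1` elsewhere (`wreathHom`). At a suitable point the first stable letter contributes `p` or its
inverse, and a later one could contribute only if `f` sent a shorter subword into `f H`. So the base
component is nontrivial, unlike that of any element of `A` (`wreathHom_notMem`). The group `P ≀ Q`
is in `C` because its base group is in `R`. -/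

theorem SubgroupClosed.mem_of_injective (hC : C.SubgroupClosed) {G K : Type u} [Group G] [Group K]
    (f : G →* K) (hf : Function.Injective f) (hK : C.Mem K) : C.Mem G :=
  C.mem_of_mulEquiv (MonoidHom.ofInjective hf).symm (hC K hK f.range)

theorem SubgroupClosed.mem_quotient_ker (hC : C.SubgroupClosed) {G K : Type u} [Group G] [Group K]
    (f : G →* K) (hK : C.Mem K) : C.Mem (G ⧸ f.ker) :=
  hC.mem_of_injective _ (QuotientGroup.kerLift_injective f) hK

/-- Some homomorphism from `G` to a member of `C` maps `g` outside the image of `S`. -/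
def Separates (C : GroupClass.{u}) {G : Type u} [Group G] (S : Subgroup G) (g : G) : Prop :=
  ∃ (Q : Type u) (_ : Group Q) (f : G →* Q), C.Mem Q ∧ f g ∉ S.map f

theorem SubgroupClosed.isResidually_iff (hC : C.SubgroupClosed) {G : Type u} [Group G] :
    C.IsResidually G ↔ ∀ g : G, g ≠ 1 → C.Separates ⊥ g := by
  refine forall₂_congr fun g _ => ⟨?_, ?_⟩
  · rintro ⟨Q, _, f, hQ, -, hg⟩
    exact ⟨Q, _, f, hQ, by simpa using hg⟩
  · rintro ⟨Q, _, f, hQ, hg⟩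
    refine ⟨f.range, inferInstance, f.rangeRestrict, hC Q hQ _, f.rangeRestrict_surjective, ?_⟩
    intro h
    exact hg (by simpa using congrArg Subtype.val h)

theorem mem_map_of_factor {G Q Q' : Type*} [Group G] [Group Q] [Group Q'] {S : Subgroup G}
    {f : G →* Q} (p : Q →* Q') {g : G} (h : f g ∈ S.map f) : (p.comp f) g ∈ S.map (p.comp f) := by
  obtain ⟨s, hs, e⟩ := h
  exact ⟨s, hs, by simp [e]⟩

/-- Finitely many elements which are separated from `S` are separated simultaneously. -/
theorem exists_separates_finite (hC : C.ProdClosed) {G : Type u} [Group G] (S : Subgroup G)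
    {T : Set G} (hT : T.Finite) (hne : ∃ (Q : Type u) (_ : Group Q), C.Mem Q)
    (h : ∀ g ∈ T, C.Separates S g) :
    ∃ (Q : Type u) (_ : Group Q) (f : G →* Q), C.Mem Q ∧ ∀ g ∈ T, f g ∉ S.map f := by
  induction T, hT using Set.Finite.induction_on with
  | empty =>
    obtain ⟨Q, _, hQ⟩ := hne
    exact ⟨Q, _, 1, hQ, by simp⟩
  | insert _ _ ih =>
    obtain ⟨Q, _, f, hQ, hf⟩ := ih fun g hg => h g (Set.mem_insert_of_mem _ hg)
    obtain ⟨Q', _, f', hQ', hf'⟩ := h _ (Set.mem_insert _ _)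
    refine ⟨Q × Q', inferInstance, f.prod f', hC _ _ hQ hQ', ?_⟩
    rintro g (rfl | hg) hmem
    · exact hf' (mem_map_of_factor (MonoidHom.snd Q Q') hmem)
    · exact hf g hg (mem_map_of_factor (MonoidHom.fst Q Q') hmem)

/-- The cosets are given only as a subbasis; intersections are handled by mapping to a product. -/
theorem exists_hom_of_isOpen (hC : C.ProdClosed) (hne : ∃ (Q : Type u) (_ : Group Q), C.Mem Q)
    {A : Type u} [Group A] {U : Set A} (hU : @IsOpen A (C.proTopology A) U) {a : A} (ha : a ∈ U) :
    ∃ (Q : Type u) (_ : Group Q) (f : A →* Q), C.Mem Q ∧ ∀ x, f x = f a → x ∈ U := by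
  have hU' : TopologicalSpace.GenerateOpen _ U := hU
  induction hU' with
  | basic s hs =>
    obtain ⟨N, _, g, hN, rfl⟩ := hs
    refine ⟨A ⧸ N, inferInstance, QuotientGroup.mk' N, hN, fun x hx => ?_⟩
    have hx' : a⁻¹ * x ∈ N := QuotientGroup.eq.1 hx.symm
    have := N.mul_mem ha hx'
    simpa [mul_assoc] using this
  | univ =>
    obtain ⟨Q, _, hQ⟩ := hne
    exact ⟨Q, _, 1, hQ, by simp⟩
  | inter s t hs ht ihs iht =>
    obtain ⟨Q, _, f, hQ, hf⟩ := ihs hs ha.1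
    obtain ⟨Q', _, f', hQ', hf'⟩ := iht ht ha.2
    refine ⟨Q × Q', inferInstance, f.prod f', hC _ _ hQ hQ', fun x hx => ?_⟩
    exact ⟨hf x (congrArg Prod.fst hx), hf' x (congrArg Prod.snd hx)⟩
  | sUnion S hS ih =>
    obtain ⟨s, hs, has⟩ := ha
    obtain ⟨Q, _, f, hQ, hf⟩ := ih s hs (hS s hs) has
    exact ⟨Q, _, f, hQ, fun x hx => ⟨s, hs, hf x hx⟩⟩

theorem isClosed_proTopology_iff (hsub : C.SubgroupClosed) (hprod : C.ProdClosed)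
    (hne : ∃ (Q : Type u) (_ : Group Q), C.Mem Q) {A : Type u} [Group A] (H : Subgroup A) :
    @IsClosed A (C.proTopology A) (H : Set A) ↔ ∀ a ∉ H, C.Separates H a := by
  let _ := C.proTopology A
  rw [← isOpen_compl_iff]
  constructor
  · intro hU a ha
    obtain ⟨Q, _, f, hQ, hf⟩ := exists_hom_of_isOpen hprod hne hU ha
    refine ⟨Q, _, f, hQ, ?_⟩
    rintro ⟨h, hh, e⟩
    exact hf h e hh
  · intro h
    refine isOpen_iff_forall_mem_open.2 fun a ha => ?_
    obtain ⟨Q, _, f, hQ, hf⟩ := h a ha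
    refine ⟨{x | a⁻¹ * x ∈ f.ker}, fun x hx hxH => hf ⟨x, hxH, ?_⟩,
      TopologicalSpace.isOpen_generateFrom_of_mem
        ⟨f.ker, inferInstance, a, hsub.mem_quotient_ker f hQ, rfl⟩, by simp⟩
    have hx' : (f a)⁻¹ * f x = 1 := by simpa [MonoidHom.mem_ker] using hx
    exact (inv_mul_eq_one.1 hx').symm

end GroupClass

/-! ### Regular wreath products and their base groups -/

namespace RegularWreathProduct

variable (D Q : Type*) [Group D] [Group Q]

/-- The embedding of the base group into the wreath product. -/
def baseHom : (Q → D) →* D ≀ᵣ Q where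
  toFun f := ⟨f, 1⟩
  map_one' := rfl
  map_mul' f g := by ext <;> simp

theorem baseHom_injective : Function.Injective (baseHom D Q) :=
  fun _ _ h => congrArg left h

/-- The projection of the base group onto its factor at the identity. -/
def evalOne : (rightHom : D ≀ᵣ Q →* Q).ker →* D where
  toFun x := x.1.left 1
  map_one' := rfl
  map_mul' x y := by
    have hx : x.1.right = 1 := x.2
    simp [hx]

theorem evalOne_surjective : Function.Surjective (evalOne D Q) :=
  fun d => ⟨⟨⟨fun _ => d, 1⟩, rfl⟩, rfl⟩

theorem rightHom_surjective : Function.Surjective (rightHom : D ≀ᵣ Q →* Q) :=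
  fun q => ⟨⟨1, q⟩, rfl⟩

/-- The base group as the kernel of the projection. -/
def baseEquiv : (Q → D) ≃* (rightHom : D ≀ᵣ Q →* Q).ker where
  toFun f := ⟨baseHom D Q f, rfl⟩
  invFun x := x.1.left
  left_inv _ := rfl
  right_inv x := by
    have hx : x.1.right = 1 := x.2
    ext
    · rfl
    · exact hx.symm
  map_mul' f g := by ext1; exact map_mul _ _ _

/-- A normal subgroup of the wreath product on which the coordinate at `1` vanishes is trivial. -/
theorem eq_bot_of_le_map_ker_evalOne (L : Subgroup (D ≀ᵣ Q)) [hL : L.Normal]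
    (h : L ≤ (evalOne D Q).ker.map (Subgroup.subtype _)) : L = ⊥ := by
  refine (Subgroup.eq_bot_iff_forall L).2 fun x hx => ?_
  have hxr : x.right = 1 := by
    obtain ⟨y, -, rfl⟩ := h hx
    exact y.2
  ext q
  -- Conjugation by `q⁻¹` moves the coordinate at `q` to the coordinate at `1`.
  · obtain ⟨y, hy, e⟩ := h (hL.conj_mem x hx ⟨1, q⁻¹⟩)
    have hy' : y.1.left 1 = 1 := hy
    have e' : y.1 = _ := e
    rw [e'] at hy'
    simpa using hy'
  · exact hxr

end RegularWreathProduct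

/-! ### Root classes and wreath products -/

namespace GroupClass

variable {C R : GroupClass.{u}}

open RegularWreathProduct

/-- In the Gruenberg condition, take the base group and its subgroup of functions trivial at `1`.
That subgroup contains no nontrivial normal subgroup of the wreath product, so `L` must be trivial.
-/
theorem IsRootClass.mem_wreathProduct (hR : R.IsRootClass) {D Q : Type u} [Group D] [Group Q]
    (hD : R.Mem D) (hQ : R.Mem Q) : R.Mem (D ≀ᵣ Q) := by
  obtain ⟨L, hL, hle, hmem⟩ := hR.gruenberg (D ≀ᵣ Q) (rightHom : D ≀ᵣ Q →* Q).ker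
    (evalOne D Q).ker
    (R.mem_of_mulEquiv
      (QuotientGroup.quotientKerEquivOfSurjective _ (rightHom_surjective D Q)).symm hQ)
    (R.mem_of_mulEquiv
      (QuotientGroup.quotientKerEquivOfSurjective _ (evalOne_surjective D Q)).symm hD)
  obtain rfl := eq_bot_of_le_map_ker_evalOne D Q L hle
  exact R.mem_of_mulEquiv QuotientGroup.quotientBot hmem

theorem IsRootClass.mem_pi (hR : R.IsRootClass) {D Q : Type u} [Group D] [Group Q]
    (hD : R.Mem D) (hQ : R.Mem Q) : R.Mem (Q → D) :=
  hR.subgroupClosed.mem_of_injective _ (baseHom_injective D Q) (hR.mem_wreathProduct hD hQ)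

/-- The wreath product of a member of `R` with a member of `C` belongs to `C`. -/
theorem IsRootClass.wreathProduct_mem_of_extension (hR : R.IsRootClass)
    (hext : ∀ (G : Type u) [Group G], IsExtensionBy R C G → C.Mem G)
    (hcard : ∀ (G : Type u) [Group G], C.Mem G →
      ∃ (Γ : Type u) (_ : Group Γ), R.Mem Γ ∧ Nonempty (G ≃ Γ))
    {D Q : Type u} [Group D] [Group Q] (hD : R.Mem D) (hQ : C.Mem Q) : C.Mem (D ≀ᵣ Q) := by
  -- The base group depends only on the cardinality of `Q`, so `Γ` in `R` can serve as index set.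
  obtain ⟨Γ, _, hΓ, ⟨e⟩⟩ := hcard Q hQ
  refine hext _ ⟨(rightHom : D ≀ᵣ Q →* Q).ker, inferInstance, ?_, ?_⟩
  · refine R.mem_of_mulEquiv (baseEquiv D Q) (R.mem_of_mulEquiv ?_ (hR.mem_pi hD hΓ))
    exact
      { toFun := fun f => f ∘ e
        invFun := fun f => f ∘ e.symm
        left_inv := fun f => by ext; simp
        right_inv := fun f => by ext; simp
        map_mul' := fun f g => rfl }
  · exact C.mem_of_mulEquiv
      (QuotientGroup.quotientKerEquivOfSurjective _ (rightHom_surjective D Q)).symm hQ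

end GroupClass

/-! ### The special HNN extension and reduced words -/

namespace SpecialHNNExtension

open HNNExtension RegularWreathProduct

variable {A : Type u} [Group A] {H : Subgroup A}

/-- The canonical embedding of the base group. -/
abbrev base (A : Type u) [Group A] (H : Subgroup A) : A →* SpecialHNNExtension A H := of

/-- The image of the associated subgroup in the special HNN extension. -/
abbrev assoc (A : Type u) [Group A] (H : Subgroup A) : Subgroup (SpecialHNNExtension A H) :=
  H.map (base A H)

/-- The stable letter. -/
abbrev stable (A : Type u) [Group A] (H : Subgroup A) : SpecialHNNExtension A H := t

theorem commute_stable {a : A} (ha : a ∈ H) : Commute (stable A H) (base A H a) :=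
  t_mul_of (φ := MulEquiv.refl H) ⟨a, ha⟩

/-- A homomorphism out of the special HNN extension. -/
def desc {K : Type*} [Group K] (f : A →* K) (x : K) (hx : ∀ a ∈ H, Commute x (f a)) :
    SpecialHNNExtension A H →* K :=
  lift f x fun a => hx a a.2

@[simp]
theorem desc_base {K : Type*} [Group K] (f : A →* K) (x : K) (hx : ∀ a ∈ H, Commute x (f a))
    (a : A) : desc f x hx (base A H a) = f a :=
  lift_of _ _ _ _

@[simp]
theorem desc_stable {K : Type*} [Group K] (f : A →* K) (x : K) (hx : ∀ a ∈ H, Commute x (f a)) :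
    desc f x hx (stable A H) = x :=
  lift_t _ _ _

/-- The stable letter commutes with no element of the base group outside `H`: let `A` act on
`Option (A ⧸ H)` fixing `none`, and the stable letter swap `none` and the coset `H`. -/
theorem mem_of_commute_stable {a : A} (h : Commute (stable A H) (base A H a)) : a ∈ H := by
  classical
  let s : Equiv.Perm (Option (A ⧸ H)) := Equiv.swap none (some ((1 : A) : A ⧸ H))
  let p : A →* Equiv.Perm (Option (A ⧸ H)) :=
    { toFun := fun a => (MulAction.toPerm a : Equiv.Perm (A ⧸ H)).optionCongr
      map_one' := by ext x : 1; cases x <;> simp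
      map_mul' := fun a b => by ext x : 1; cases x <;> simp [mul_smul] }
  have hp (b : A) (x : A ⧸ H) : p b (some x) = some (b • x) := rfl
  have hp' (b : A) : p b none = none := rfl
  have hs (b : A) (hb : b ∈ H) : Commute s (p b) := by
    have hfix : b • ((1 : A) : A ⧸ H) = ((1 : A) : A ⧸ H) := by
      rw [MulAction.Quotient.smul_coe, QuotientGroup.eq]
      simpa using hb
    rw [Commute, SemiconjBy, Equiv.swap_mul_eq_mul_swap]
    congr 2
    rw [Equiv.Perm.inv_eq_iff_eq, hp, hfix]
  have key := (h.map (desc p s hs)).eq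
  rw [desc_base, desc_stable] at key
  have := Equiv.congr_fun key none
  simp only [Equiv.Perm.mul_apply, hp', s, Equiv.swap_apply_left, hp] at this
  rw [Option.some_inj, MulAction.Quotient.smul_coe, QuotientGroup.eq] at this
  simpa using this

/-- The element represented by a word in the letters `tᵘ a`. -/
def wordProd (H : Subgroup A) (l : List (ℤˣ × A)) : SpecialHNNExtension A H :=
  (l.map fun x => stable A H ^ (x.1 : ℤ) * base A H x.2).prod

@[simp]
theorem wordProd_nil : wordProd H [] = 1 := rfl

@[simp]
theorem wordProd_cons (x : ℤˣ × A) (l : List (ℤˣ × A)) :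
    wordProd H (x :: l) = stable A H ^ (x.1 : ℤ) * base A H x.2 * wordProd H l := by
  simp [wordProd]

/-- A word is reduced if it has no subword `tᵘ h t⁻ᵘ` with `h ∈ H`. -/
def Reduced (H : Subgroup A) (l : List (ℤˣ × A)) : Prop :=
  l.IsChain fun x y => x.2 ∈ H → x.1 = y.1

theorem exists_reduced (g : SpecialHNNExtension A H) :
    ∃ (a : A) (l : List (ℤˣ × A)), Reduced H l ∧ g = base A H a * wordProd H l := by
  obtain ⟨d⟩ := NormalWord.TransversalPair.nonempty A H H
  refine ⟨(NormalWord.equiv _ d g).head, (NormalWord.equiv _ d g).toList, ?_,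
    ((NormalWord.equiv _ d).symm_apply_apply g).symm⟩
  refine (NormalWord.equiv _ d g).chain.imp fun x y h hx => h ?_
  -- Both associated subgroups are `H`, so the sign of the letter is irrelevant.
  rcases Int.units_eq_one_or x.1 with e | e <;> rw [e] <;> exact hx

/-! ### Lifting a homomorphism to a wreath product -/

section Wreath

variable {Q P : Type*} [Group Q] [Group P] (f : SpecialHNNExtension A H →* Q) (p : P)

open Classical in
/-- The function on `Q` with value `p` on the image of `H` and `1` elsewhere. -/
noncomputable def bump : Q → P := fun x => if x ∈ (assoc A H).map f then p else 1

theorem bump_of_notMem {x : Q} (hx : x ∉ (assoc A H).map f) : bump f p x = 1 := if_neg hx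

theorem bump_congr {x y : Q} (h : x ∈ (assoc A H).map f ↔ y ∈ (assoc A H).map f) :
    bump f p x = bump f p y := by
  by_cases hy : y ∈ (assoc A H).map f
  · exact (if_pos (h.2 hy)).trans (if_pos hy).symm
  · exact (if_neg (mt h.1 hy)).trans (if_neg hy).symm

theorem bump_one : bump f p 1 = p := if_pos (one_mem _)

/-- The homomorphism to the wreath product lifting `f` which maps the base group to the
complement and the stable letter to `bump f p` times its image under `f`. -/
noncomputable def wreathHom : SpecialHNNExtension A H →* P ≀ᵣ Q :=
  desc (RegularWreathProduct.inl.comp (f.comp (base A H))) ⟨bump f p, f (stable A H)⟩ fun a ha => by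
    have hfa : f (base A H a) ∈ (assoc A H).map f := ⟨_, ⟨a, ha, rfl⟩, rfl⟩
    rw [Commute, SemiconjBy]
    ext x
    · have : (f (base A H a))⁻¹ * x ∈ (assoc A H).map f ↔ x ∈ (assoc A H).map f :=
        Subgroup.mul_mem_cancel_left _ (inv_mem hfa)
      simpa [RegularWreathProduct.inl] using bump_congr f p this.symm
    · simpa [RegularWreathProduct.inl] using ((commute_stable ha).map f).eq

theorem wreathHom_stable : wreathHom f p (stable A H) = ⟨bump f p, f (stable A H)⟩ :=
  desc_stable _ _ _

@[simp]
theorem wreathHom_base_left (a : A) : (wreathHom f p (base A H a)).left = 1 := by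
  rw [wreathHom, desc_base]; rfl

theorem wreathHom_right (g : SpecialHNNExtension A H) : (wreathHom f p g).right = f g := by
  have : rightHom.comp (wreathHom f p) = f := by
    refine HNNExtension.hom_ext ?_ ?_
    · ext a
      change (wreathHom f p (base A H a)).right = _
      rw [wreathHom, desc_base]; rfl
    · change (wreathHom f p (stable A H)).right = _
      rw [wreathHom_stable]
  exact DFunLike.congr_fun this g

theorem wreathHom_mul_left (g k : SpecialHNNExtension A H) (x : Q) :
    (wreathHom f p (g * k)).left x =
      (wreathHom f p g).left x * (wreathHom f p k).left ((f g)⁻¹ * x) := by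
  simp [wreathHom_right]

theorem wreathHom_stable_left : (wreathHom f p (stable A H)).left = bump f p := by
  rw [wreathHom_stable]

theorem wreathHom_stable_inv_left (x : Q) :
    (wreathHom f p (stable A H)⁻¹).left x = (bump f p (f (stable A H) * x))⁻¹ := by
  rw [map_inv, wreathHom_stable]; simp

/-- The coordinate at `y` of the image of a word all of whose stable letters miss `y`. -/
theorem wreathHom_wordProd_left (l : List (ℤˣ × A)) (y : Q)
    (h : ∀ m x r, l = m ++ x :: r →
      (x.1 = 1 → (f (wordProd H m))⁻¹ * y ∉ (assoc A H).map f) ∧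
      (x.1 = -1 → f (stable A H) * ((f (wordProd H m))⁻¹ * y) ∉ (assoc A H).map f)) :
    (wreathHom f p (wordProd H l)).left y = 1 := by
  induction l generalizing y with
  | nil => simp
  | cons x l ih =>
    have h0 := h [] x l rfl
    rw [wordProd_cons, wreathHom_mul_left, ih, mul_one, wreathHom_mul_left, wreathHom_base_left]
    · simp only [wordProd_nil, map_one, inv_one, one_mul] at h0
      rcases Int.units_eq_one_or x.1 with e | e
      · simp [e, wreathHom_stable_left, bump_of_notMem f p (h0.1 e)]
      · simp [e, wreathHom_stable_inv_left, bump_of_notMem f p (h0.2 e), -map_inv]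
    · rintro m z r rfl
      simpa [mul_assoc] using h (x :: m) z r rfl

theorem mem_map_stable_conj {q : Q} :
    f (stable A H) * q * (f (stable A H))⁻¹ ∈ (assoc A H).map f ↔ q ∈ (assoc A H).map f := by
  have hc : ∀ k ∈ (assoc A H).map f, f (stable A H) * k * (f (stable A H))⁻¹ = k := by
    rintro _ ⟨_, ⟨a, ha, rfl⟩, rfl⟩
    rw [((commute_stable ha).map f).eq, mul_inv_cancel_right]
  refine ⟨fun h => ?_, fun h => (hc q h).symm ▸ h⟩
  have := hc _ h
  rw [mul_left_inj, mul_right_inj] at this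
  rwa [this] at h

/-- If the relevant shorter subwords of a word are separated from `H` by `f`, then the word is
separated from `H` by the induced homomorphism to the wreath product. -/
theorem wreathHom_notMem (hp : p ≠ 1) (a : A) (x : ℤˣ × A) (l : List (ℤˣ × A))
    (hsame : ∀ m z r, l = m ++ z :: r → z.1 = x.1 → f (wordProd H (x :: m)) ∉ (assoc A H).map f)
    (hdiff : ∀ m z r, l = m ++ z :: r → z.1 ≠ x.1 →
      f (base A H x.2 * wordProd H m) ∉ (assoc A H).map f) :
    wreathHom f p (base A H a * wordProd H (x :: l)) ∉ (assoc A H).map (wreathHom f p) := by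
  suffices h : (wreathHom f p (base A H a * wordProd H (x :: l))).left ≠ 1 by
    rintro ⟨_, ⟨b, -, rfl⟩, e⟩
    exact h (e ▸ wreathHom_base_left f p b)
  rcases x with ⟨u, b⟩
  rcases Int.units_eq_one_or u with rfl | rfl
  · refine fun h => hp ?_
    -- After the prefix `a`, the letter `t` is evaluated at `1`, where `bump` is `p`.
    have h1 := congrFun h (f (base A H a))
    rw [wordProd_cons, wreathHom_mul_left, wreathHom_base_left, wreathHom_mul_left,
      wreathHom_wordProd_left, wreathHom_mul_left, wreathHom_base_left] at h1
    · simpa [wreathHom_stable_left, bump_one] using h1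
    · intro m z r hl
      have hs := hsame m z r hl
      have hd := hdiff m z r hl
      refine ⟨fun hz hmem => hs hz ?_, fun hz hmem => hd (by simp [hz]) ?_⟩
      · rw [← inv_mem_iff]
        simpa [mul_assoc] using hmem
      · rw [← inv_mem_iff, ← mem_map_stable_conj]
        convert hmem using 1
        simp [mul_assoc]
  · refine fun h => hp ?_
    -- The letter `t⁻¹` contributes the inverse of `bump` at a point multiplied by `f t`; the extra
    -- factor cancels this shift.
    have h1 := congrFun h (f (base A H a) * (f (stable A H))⁻¹)
    rw [wordProd_cons, wreathHom_mul_left, wreathHom_base_left, wreathHom_mul_left,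
      wreathHom_wordProd_left, wreathHom_mul_left, wreathHom_base_left] at h1
    · simpa [wreathHom_stable_inv_left, bump_one, -map_inv] using h1
    · intro m z r hl
      have hs := hsame m z r hl
      have hd := hdiff m z r hl
      refine ⟨fun hz hmem => hd (by simp [hz]) ?_, fun hz hmem => hs hz ?_⟩
      · rw [← inv_mem_iff]
        simpa [mul_assoc] using hmem
      · rw [← inv_mem_iff, ← mem_map_stable_conj]
        convert hmem using 1
        simp [mul_assoc]

end Wreath

/-! ### Induction on word length and the equivalence -/

open GroupClass

variable {C R : GroupClass.{u}}

/-- If `H` is closed in `A`, then every reduced word outside `H` is separated from `H`. -/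
theorem separates_reduced (hR : R.IsRootClass) (hRC : ∀ (G : Type u) [Group G], R.Mem G → C.Mem G)
    (hCprod : C.ProdClosed)
    (hext : ∀ (G : Type u) [Group G], IsExtensionBy R C G → C.Mem G)
    (hcard : ∀ (G : Type u) [Group G], C.Mem G →
      ∃ (Γ : Type u) (_ : Group Γ), R.Mem Γ ∧ Nonempty (G ≃ Γ))
    (hH : ∀ a ∉ H, C.Separates H a) (n : ℕ) :
    ∀ (a : A) (l : List (ℤˣ × A)), l.length = n → Reduced H l → (l = [] → a ∉ H) →
      C.Separates (assoc A H) (base A H a * wordProd H l) := by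
  induction n using Nat.strong_induction_on with
  | _ n ih =>
  intro a l hn hl ha
  rcases l with _ | ⟨x, l⟩
  · obtain ⟨Q, _, f, hQ, hf⟩ := hH a (ha rfl)
    refine ⟨Q, _, desc f 1 fun b _ => Commute.one_left _, hQ, ?_⟩
    rintro ⟨_, ⟨b, hb, rfl⟩, e⟩
    exact hf ⟨b, hb, by simpa using e⟩
  obtain ⟨P, _, hPn, hP⟩ := hR.exists_nontrivial
  obtain ⟨p, hp⟩ := exists_ne (1 : P)
  -- Only the separable candidates are collected; the induction hypothesis shows below that those
  -- needed are among them.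
  have hfin : {g | C.Separates (assoc A H) g ∧ ∃ m ∈ {m | m ∈ l.inits},
      g = wordProd H (x :: m) ∨ g = base A H x.2 * wordProd H m}.Finite := by
    have h1 : {m | m ∈ l.inits}.Finite := l.inits.finite_toSet
    refine ((h1.image fun m => wordProd H (x :: m)).union
      (h1.image fun m => base A H x.2 * wordProd H m)).subset ?_
    rintro g ⟨-, m, hm, rfl | rfl⟩
    · exact Or.inl ⟨m, hm, rfl⟩
    · exact Or.inr ⟨m, hm, rfl⟩
  obtain ⟨Q, _, f, hQ, hf⟩ := exists_separates_finite hCprod (assoc A H) hfin ⟨P, _, hRC P hP⟩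
    fun g hg => hg.1
  refine ⟨P ≀ᵣ Q, _, wreathHom f p, hR.wreathProduct_mem_of_extension hext hcard hP hQ, ?_⟩
  refine wreathHom_notMem f p hp a x l ?_ ?_
  · rintro m z r rfl -
    refine hf _ ⟨?_, m, by simp, Or.inl rfl⟩
    have hred : Reduced H (x :: m) := by
      rw [← List.cons_append] at hl
      exact List.IsChain.left_of_append hl
    simpa using ih (m.length + 1) (by simp at hn; omega) 1 (x :: m) rfl hred (by simp)
  · rintro m z r rfl hz
    refine hf _ ⟨?_, m, by simp, Or.inr rfl⟩
    have hred : Reduced H m := List.IsChain.left_of_append (List.IsChain.tail hl)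
    refine ih m.length (by simp at hn; omega) x.2 m rfl hred ?_
    rintro rfl hx
    -- For empty `m`, adjacent stable letters of opposite sign force `x.2 ∉ H` by reducedness.
    exact hz ((List.isChain_cons_cons.1 hl).1 hx).symm

/-- The special HNN extension is residually `C` if and only if its base group is and the associated
subgroup is closed in the pro-`C` topology. -/
theorem isResidually_iff (A : Type u) [Group A] (H : Subgroup A) (C R : GroupClass.{u})
    (hR : R.IsRootClass)
    (hRC : ∀ (G : Type u) [Group G], R.Mem G → C.Mem G)
    (hCsub : C.SubgroupClosed) (hCprod : C.ProdClosed)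
    (hext : ∀ (G : Type u) [Group G], GroupClass.IsExtensionBy R C G → C.Mem G)
    (hcard : ∀ (G : Type u) [Group G], C.Mem G →
      ∃ (Γ : Type u) (_ : Group Γ), R.Mem Γ ∧ Nonempty (G ≃ Γ)) :
    C.IsResidually (SpecialHNNExtension A H) ↔
      (C.IsResidually A ∧ @IsClosed A (C.proTopology A) (H : Set A)) := by
  obtain ⟨P, _, -, hP⟩ := hR.exists_nontrivial
  rw [isClosed_proTopology_iff hCsub hCprod ⟨P, _, hRC P hP⟩, hCsub.isResidually_iff,
    hCsub.isResidually_iff]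
  constructor
  · intro h
    refine ⟨fun a ha => ?_, fun a ha => ?_⟩
    · obtain ⟨Q, _, f, hQ, hf⟩ := h (base A H a)
        ((map_ne_one_iff (base A H) (HNNExtension.of_injective _)).2 ha)
      exact ⟨Q, _, f.comp (base A H), hQ, by simpa using hf⟩
    · have hne : stable A H * base A H a * (stable A H)⁻¹ * (base A H a)⁻¹ ≠ 1 := fun e =>
        ha (mem_of_commute_stable (mul_inv_eq_iff_eq_mul.1 (mul_inv_eq_one.1 e)))
      obtain ⟨Q, _, f, hQ, hf⟩ := h _ hne
      refine ⟨Q, _, f.comp (base A H), hQ, ?_⟩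
      rintro ⟨b, hb, e⟩
      have hc : Commute (f (stable A H)) (f (base A H a)) := by
        have := (commute_stable hb).map f
        rwa [show f (base A H b) = f (base A H a) from e] at this
      refine hf ?_
      simp [hc.eq]
  · rintro ⟨hA, hH⟩ g hg
    by_cases hgH : g ∈ assoc A H
    · obtain ⟨a, -, rfl⟩ := hgH
      obtain ⟨Q, _, f, hQ, hf⟩ := hA a fun e => hg (by rw [e, map_one])
      exact ⟨Q, _, desc f 1 fun b _ => Commute.one_left _, hQ, by simpa using hf⟩
    · obtain ⟨a, l, hl, rfl⟩ := exists_reduced g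
      obtain ⟨Q, _, f, hQ, hf⟩ := separates_reduced hR hRC hCprod hext hcard hH _ a l rfl hl
        (by rintro rfl ha; exact hgH ⟨a, ha, by simp⟩)
      exact ⟨Q, _, f, hQ, fun h => hf (Subgroup.map_mono bot_le h)⟩

end SpecialHNNExtension

theorem theorem7 (A : Type u) [Group A] (H : Subgroup A) (C R : GroupClass.{u})
    (hR : R.IsRootClass)
    (hRC : ∀ (G : Type u) [Group G], R.Mem G → C.Mem G)
    (hCsub : C.SubgroupClosed) (hCprod : C.ProdClosed)
    (hext : ∀ (G : Type u) [Group G], GroupClass.IsExtensionBy R C G → C.Mem G)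
    (hcard : ∀ (G : Type u) [Group G], C.Mem G →
      ∃ (Γ : Type u) (_ : Group Γ), R.Mem Γ ∧ Nonempty (G ≃ Γ)) :
    C.IsResidually (SpecialHNNExtension A H) ↔
      (C.IsResidually A ∧ @IsClosed A (C.proTopology A) (H : Set A)) :=
  SpecialHNNExtension.isResidually_iff A H C R hR hRC hCsub hCprod hext hcard
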